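/- Let $G$ be a real reductive Lie group with Lie algebra $\mathfrak g$: $G$ has finitely many connected components and $\mathfrak g=[\mathfrak g,\mathfrak g]\oplus\mathfrak z(\mathfrak g)$ with $[\mathfrak g,\mathfrak g]$ semisimple. Let $\theta$ be a Cartan involution of $G$, with compact fixed point group $K$ and induced decomposition $\mathfrak g=\mathfrak k\oplus\mathfrak p$, so that $K\times\mathfrak p\to G$, $(k,v)\mapsto k\exp v$, is a diffeomorphism. Let $\mathscr M$ be a Hausdorff space with a continuous $G$-action, with stabilizers $G_x$ and their Lie algebras $\mathfrak g_x=\{\xi\in\mathfrak g:\exp(\mathbb R\xi)\subset G_x\}$. Let $\Psi:\mathscr M\times G\to\mathbb R$ be a Kempf–Ness function for $(\mathscr M,G,K)$, i.e. for all $x\in\mathscr M$, $g,h\in G$, $k\in K$, $v\in\mathfrak p$: (P1) $\Psi(x,\cdot)$ is smooth; (P2) $\Psi(x,kg)=\Psi(x,g)$; (P3) $\frac{d^2}{dt^2}\Psi(x,\exp(tv))\ge 0$ for all $t\in\mathbb R$, and $\frac{d^2}{dt^2}\big|_{t=0}\Psi(x,\exp(tv))=0$ if and only if $\exp(\mathbb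 Rv)\subset G_x$; (P4) $\Psi(x,g)+\Psi(gx,h)=\Psi(x,hg)$; (P5) the gradient map $\mathfrak F:\mathscr M\to\mathfrak p^*$, $\langle\mathfrak F(x),v\rangle=\frac{d}{dt}\big|_{t=0}\Psi(x,\exp(tv))$, is continuous. For a subgroup $H\subset G$ with Lie algebra $\mathfrak h$ (for instance $H=G$), a point $y$ is called polystable for $H$ if there is $h\in H$ such that $\mathfrak F(hy)$ vanishes on $\mathfrak h\cap\mathfrak p$; it is called stable for $H$ if moreover $\mathfrak h\cap\mathfrak g_y$ is conjugate, under $\mathrm{Ad}(H)$, to a subalgebra of $\mathfrak h\cap\mathfrak k$. Let $x\in\mathscr M$ be polystable for $G$. Then there exist $g\in G$ and an abelian subalgebra $\mathfrak a\subset\mathfrak p$ with $\mathfrak a\subset\mathfrak g_{gx}$ such that $gx$ is polystable for $$G^{\mathfrak a}=\{h\in G:\ \mathrm{Ad}(h)\xi=\xi\ \text{ for all }\xi\in\mathfrak a\},$$ and such that $gx$ is stable for the semisimple part $G'_{ss}$ of $G^{\mathfrak a}$, i.e. for the analytic subgroup of $G$ with Lie algebra $[\mathfrak g^{\mathfrak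 a},\mathfrak g^{\mathfrak a}]$, where $\mathfrak g^{\mathfrak a}=\{\eta\in\mathfrak g:[\eta,\xi]=0\ \text{ for all }\xi\in\mathfrak a\}$ is the Lie algebra of $G^{\mathfrak a}$. -/

import Mathlib

open scoped Manifold ContDiff

noncomputable section

section LieTheory

variable (n : ℕ) {G : Type*} [TopologicalSpace G] [ChartedSpace (EuclideanSpace ℝ (Fin n)) G]
  [Group G]

/-- A smooth real Lie group is of the class required for its Lie algebra. -/
instance lieGroupMinSmoothness [LieGroup (𝓡 n) ∞ G] : LieGroup (𝓡 n) (minSmoothness ℝ 3) G := by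
  rw [minSmoothness_of_isRCLikeNormedField]
  infer_instance

variable {n}

open Classical in
/-- The exponential map of a Lie group: `exp v = γ 1`, where `γ` is the integral curve of the
left-invariant vector field of `v` with `γ 0 = 1`. (Such a `γ` always exists and is unique.) -/
def lieExp (v : GroupLieAlgebra (𝓡 n) G) : G :=
  if h : ∃ γ : ℝ → G, γ 0 = 1 ∧ IsMIntegralCurve (I := 𝓡 n) γ (mulInvariantVectorField v) then
    h.choose 1
  else 1

variable (n)

/-- The differential at the identity of a group endomorphism of `G`, as an endomorphism of the Lie
algebra (note that `f 1 = 1`). -/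
def lieDifferential (f : G →* G) :
    GroupLieAlgebra (𝓡 n) G →ₗ[ℝ] GroupLieAlgebra (𝓡 n) G :=
  (show EuclideanSpace ℝ (Fin n) →L[ℝ] EuclideanSpace ℝ (Fin n) from
    mfderiv (𝓡 n) (𝓡 n) f 1).toLinearMap

/-- The adjoint representation: `Ad g` is the differential at `1` of `h ↦ g * h * g⁻¹`. -/
def lieAd (g : G) : GroupLieAlgebra (𝓡 n) G →ₗ[ℝ] GroupLieAlgebra (𝓡 n) G :=
  lieDifferential n (MulAut.conj g).toMonoidHom

theorem lieAd_one (ξ : GroupLieAlgebra (𝓡 n) G) : lieAd n (1 : G) ξ = ξ := by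
  have e : ((MulAut.conj (1 : G)).toMonoidHom : G → G) = id := by
    funext y
    simp
  unfold lieAd lieDifferential
  rw [e, mfderiv_id]
  rfl

/-- The subgroup of fixed points of `θ`. -/
def fixedSubgroup (θ : G ≃* G) : Subgroup G where
  carrier := {g | θ g = g}
  mul_mem' := by
    intro a b ha hb
    change θ (a * b) = a * b
    rw [map_mul, show θ a = a from ha, show θ b = b from hb]
  one_mem' := by simp
  inv_mem' := by
    intro a ha
    change θ a⁻¹ = a⁻¹
    rw [map_inv, show θ a = a from ha]

/-- The `1`-eigenspace of the differential of `θ`. -/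
def kPart (θ : G ≃* G) : Submodule ℝ (GroupLieAlgebra (𝓡 n) G) :=
  Module.End.eigenspace (lieDifferential n θ.toMonoidHom) 1

/-- The `-1`-eigenspace of the differential of `θ`. -/
def pPart (θ : G ≃* G) : Submodule ℝ (GroupLieAlgebra (𝓡 n) G) :=
  Module.End.eigenspace (lieDifferential n θ.toMonoidHom) (-1)

variable [LieGroup (𝓡 n) ∞ G]

variable (G) in
/-- Real reductive Lie groups: finitely many connected components, and
`𝔤 = [𝔤, 𝔤] ⊕ 𝔷(𝔤)` with `[𝔤, 𝔤]` semisimple. -/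
structure IsRealReductive : Prop where
  finite_components : Finite (ConnectedComponents G)
  isCompl : IsCompl (LieAlgebra.derivedSeries ℝ (GroupLieAlgebra (𝓡 n) G) 1)
    (LieAlgebra.center ℝ (GroupLieAlgebra (𝓡 n) G))
  isSemisimple : LieAlgebra.IsSemisimple ℝ
    (LieAlgebra.derivedSeries ℝ (GroupLieAlgebra (𝓡 n) G) 1)

/-- `θ` is a (global) Cartan involution of `G`, with fixed point set the compact group `K` and with
`𝔭` the `-1`-eigenspace of its differential. -/
structure IsCartanInvolution (θ : G ≃* G) : Prop where
  smooth : ContMDiff (𝓡 n) (𝓡 n) ∞ θ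
  involutive : ∀ g, θ (θ g) = g
  /-- `θ` induces a Cartan involution of the semisimple algebra `[𝔤, 𝔤]`: the form
  `-B(ξ, θ ξ)`, with `B` the Killing form, is positive definite there. -/
  killing_neg : ∀ ξ ∈ LieAlgebra.derivedSeries ℝ (GroupLieAlgebra (𝓡 n) G) 1, ξ ≠ 0 →
    killingForm ℝ (GroupLieAlgebra (𝓡 n) G) ξ (lieDifferential n θ.toMonoidHom ξ) < 0
  isCompact_fixed : IsCompact (fixedSubgroup θ : Set G)
  /-- `K × 𝔭 → G`, `(k, v) ↦ k exp v` is a diffeomorphism: it is bijective, and the `𝔭`-component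
  `P` of its inverse (hence also the `K`-component `g ↦ g exp (-P g)`) is smooth. -/
  polar : ∃ P : G → EuclideanSpace ℝ (Fin n),
    ContMDiff (𝓡 n) 𝓘(ℝ, EuclideanSpace ℝ (Fin n)) ∞ P ∧
    (∀ g, (P g : GroupLieAlgebra (𝓡 n) G) ∈ pPart n θ ∧
      g * (lieExp (P g : GroupLieAlgebra (𝓡 n) G))⁻¹ ∈ fixedSubgroup θ) ∧
    ∀ k ∈ fixedSubgroup θ, ∀ v ∈ pPart n θ, P (k * lieExp v) = v

theorem lieAd_mul (g h : G) (ξ : GroupLieAlgebra (𝓡 n) G) :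
    lieAd n (g * h) ξ = lieAd n g (lieAd n h ξ) := by
  have smooth : ∀ (a x : G), MDifferentiableAt (𝓡 n) (𝓡 n) (MulAut.conj a).toMonoidHom x := by
    intro a x
    have H : ContMDiff (𝓡 n) (𝓡 n) ∞ (fun y : G => a * y * a⁻¹) :=
      (contMDiff_mul_right (a := a⁻¹)).comp (contMDiff_mul_left (a := a))
    exact (H x).mdifferentiableAt (by simp)
  have e : ((MulAut.conj (g * h)).toMonoidHom : G → G) =
      (MulAut.conj g).toMonoidHom ∘ (MulAut.conj h).toMonoidHom := by
    funext y
    simp [mul_assoc]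
  have h1 : (MulAut.conj h).toMonoidHom (1 : G) = 1 := map_one _
  have key := mfderiv_comp (I := 𝓡 n) (I' := 𝓡 n) (I'' := 𝓡 n) (1 : G)
    (smooth g ((MulAut.conj h).toMonoidHom 1)) (smooth h 1)
  unfold lieAd lieDifferential
  rw [e, key, h1]
  rfl

/-- The centralizer `G^𝔞 = {g : Ad g ξ = ξ for all ξ ∈ 𝔞}`. -/
def groupCentralizer (𝔞 : LieSubalgebra ℝ (GroupLieAlgebra (𝓡 n) G)) : Subgroup G where
  carrier := {g | ∀ ξ ∈ 𝔞, lieAd n g ξ = ξ}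
  mul_mem' := by
    intro g h hg hh ξ hξ
    rw [lieAd_mul, hh ξ hξ, hg ξ hξ]
  one_mem' := fun ξ _ => lieAd_one n ξ
  inv_mem' := by
    intro g hg ξ hξ
    conv_lhs => rw [← hg ξ hξ]
    rw [← lieAd_mul, inv_mul_cancel, lieAd_one]

/-- The Lie algebra `𝔤^𝔞 = {η : [η, ξ] = 0 for all ξ ∈ 𝔞}` of `G^𝔞`. -/
def algebraCentralizer (𝔞 : LieSubalgebra ℝ (GroupLieAlgebra (𝓡 n) G)) :
    LieSubalgebra ℝ (GroupLieAlgebra (𝓡 n) G) where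
  carrier := {η | ∀ ξ ∈ 𝔞, ⁅η, ξ⁆ = 0}
  add_mem' := by
    intro a b ha hb ξ hξ
    rw [add_lie, ha ξ hξ, hb ξ hξ, add_zero]
  zero_mem' := by
    intro ξ _
    exact zero_lie ξ
  smul_mem' := by
    intro c a ha ξ hξ
    rw [smul_lie, ha ξ hξ, smul_zero]
  lie_mem' := by
    intro a b ha hb ξ hξ
    rw [lie_lie, ha ξ hξ, hb ξ hξ, lie_zero, lie_zero, sub_zero]

/-- The derived algebra `[𝔥, 𝔥]` of a subalgebra `𝔥` of `𝔤`, as a subalgebra of `𝔤`. -/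
def derivedSubalgebra (𝔥 : LieSubalgebra ℝ (GroupLieAlgebra (𝓡 n) G)) :
    LieSubalgebra ℝ (GroupLieAlgebra (𝓡 n) G) :=
  LieSubalgebra.map 𝔥.incl (LieAlgebra.derivedSeries ℝ 𝔥 1).toLieSubalgebra

/-- The analytic subgroup of `G` with Lie algebra `𝔥`, i.e. the subgroup generated by `exp 𝔥`. -/
def analyticSubgroup (𝔥 : LieSubalgebra ℝ (GroupLieAlgebra (𝓡 n) G)) : Subgroup G :=
  Subgroup.closure (lieExp '' (𝔥 : Set (GroupLieAlgebra (𝓡 n) G)))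

end LieTheory

section Stability

variable {n : ℕ} {G : Type*} [TopologicalSpace G] [ChartedSpace (EuclideanSpace ℝ (Fin n)) G]
  [Group G] {M : Type*} [TopologicalSpace M] [MulAction G M]

variable (n) in
/-- The pairing `⟨𝔉(x), v⟩ = d/dt Ψ(x, exp (t v))` at `t = 0`, for `v ∈ 𝔭`. -/
def gradientMap (Ψ : M → G → ℝ) (x : M) (v : GroupLieAlgebra (𝓡 n) G) : ℝ :=
  deriv (fun t : ℝ => Ψ x (lieExp (t • v))) 0

variable (G) in
/-- The Lie algebra `𝔤_x` of the stabilizer `G_x`: those `ξ` with `exp (ℝ ξ) ⊆ G_x`. -/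
def stabilizerAlgebra (x : M) : Set (GroupLieAlgebra (𝓡 n) G) :=
  {ξ | ∀ t : ℝ, lieExp (t • ξ) ∈ MulAction.stabilizer G x}

/-- Kempf-Ness functions for `(M, G, K)`, with `K` and `𝔭` given by the Cartan involution `θ`. -/
structure IsKempfNess (θ : G ≃* G) (Ψ : M → G → ℝ) : Prop where
  smooth : ∀ x, ContMDiff (𝓡 n) 𝓘(ℝ, ℝ) ∞ (Ψ x)
  left_invariant : ∀ x, ∀ k ∈ fixedSubgroup θ, ∀ g, Ψ x (k * g) = Ψ x g
  convex : ∀ x, ∀ v ∈ pPart n θ, ∀ t : ℝ,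
    0 ≤ iteratedDeriv 2 (fun s : ℝ => Ψ x (lieExp (s • v))) t
  strict : ∀ x, ∀ v ∈ pPart n θ,
    iteratedDeriv 2 (fun s : ℝ => Ψ x (lieExp (s • v))) 0 = 0 ↔
      ∀ t : ℝ, lieExp (t • v) ∈ MulAction.stabilizer G x
  cocycle : ∀ x g h, Ψ x g + Ψ (g • x) h = Ψ x (h * g)
  /-- Continuity of `𝔉 : M → 𝔭*`; as `𝔭` is finite-dimensional, this is continuity of
  `x ↦ ⟨𝔉(x), v⟩` for every `v ∈ 𝔭`. -/
  continuous_gradientMap : ∀ v ∈ pPart n θ, Continuous (fun x => gradientMap n Ψ x v)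

variable [LieGroup (𝓡 n) ∞ G]

/-- `x` is polystable for the subgroup `H` of `G` with Lie algebra `𝔥`, with respect to the
restriction of `Ψ` to `M × H`: the orbit `H x` meets the zero set of the gradient map of `H`, which
is `y ↦ 𝔉(y)` restricted to `𝔥 ∩ 𝔭`. -/
def IsPolystable (θ : G ≃* G) (Ψ : M → G → ℝ) (H : Subgroup G)
    (𝔥 : LieSubalgebra ℝ (GroupLieAlgebra (𝓡 n) G)) (x : M) : Prop :=
  ∃ h ∈ H, ∀ v ∈ 𝔥, v ∈ pPart n θ → gradientMap n Ψ (h • x) v = 0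

/-- `x` is stable for the subgroup `H` of `G` with Lie algebra `𝔥`: it is polystable for `H`, and
the stabilizer algebra `𝔥_x = 𝔥 ∩ 𝔤_x` is conjugate in `H` to a subalgebra of `𝔥 ∩ 𝔨`. -/
def IsStable (θ : G ≃* G) (Ψ : M → G → ℝ) (H : Subgroup G)
    (𝔥 : LieSubalgebra ℝ (GroupLieAlgebra (𝓡 n) G)) (x : M) : Prop :=
  IsPolystable θ Ψ H 𝔥 x ∧
    ∃ h ∈ H, ∀ ξ ∈ 𝔥, ξ ∈ stabilizerAlgebra G x → lieAd n h ξ ∈ 𝔥 ∧ lieAd n h ξ ∈ kPart n θ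

end Stability

end

/-!
Let `y = g x` be a zero of the gradient map `𝔉`. The function `φ h = Ψ(y, h⁻¹)` is right
`K`-invariant and has a critical point at `1`, so its Hessian along left-invariant fields vanishes
as soon as one argument lies in `𝔨`. By the cocycle identity `φ` is additive under left translation
by `G_y`, so the Hessian also vanishes when its first argument lies in `𝔤_y`. Hence the
`𝔭`-component of an element of `𝔤_y` is isotropic, and by (P3) it lies in `𝔤_y` again.

Take `𝔞` maximal among the abelian subalgebras contained in `𝔭 ∩ 𝔤_y`. If `b` is the `𝔭`-component
of an element of `[𝔤^𝔞, 𝔤^𝔞] ∩ 𝔤_y`, then `b` lies in `𝔤_y` and in the `θ`-stable algebra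
`[𝔤^𝔞, 𝔤^𝔞]`; in particular it commutes with `𝔞`, so `b ∈ 𝔞` by maximality. Invariance of the
Killing form makes `𝔞` orthogonal to `[𝔤^𝔞, 𝔤^𝔞]`, so `b` is orthogonal to itself, and `b = 0`
because the Killing form is definite on `𝔭 ∩ [𝔤, 𝔤]`.
-/

section Algebra

theorem exists_add_eq_of_involutive {R V : Type*} [CommRing R] [Invertible (2 : R)]
    [AddCommGroup V] [Module R V] {σ : Module.End R V} (hσ : Function.Involutive σ)
    {W : Submodule R V} (hW : ∀ v ∈ W, σ v ∈ W) {v : V} (hv : v ∈ W) :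
    ∃ a ∈ W ⊓ σ.eigenspace 1, ∃ b ∈ W ⊓ σ.eigenspace (-1), a + b = v := by
  refine ⟨⅟(2 : R) • (v + σ v), ⟨W.smul_mem _ (add_mem hv (hW v hv)), ?_⟩,
    ⅟(2 : R) • (v - σ v), ⟨W.smul_mem _ (sub_mem hv (hW v hv)), ?_⟩, ?_⟩
  · rw [SetLike.mem_coe, Module.End.mem_eigenspace_iff, map_smul, map_add, hσ v, one_smul, add_comm]
  · rw [SetLike.mem_coe, Module.End.mem_eigenspace_iff, map_smul, map_sub, hσ v, neg_one_smul,
      ← smul_neg, neg_sub]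
  · rw [← smul_add, add_add_sub_cancel, ← two_smul R v, invOf_smul_smul]

/-- The isotropic vectors in a submodule on which a (not necessarily symmetric) bilinear form is
positive semidefinite. They form a submodule because of the semidefiniteness. -/
def isotropicSubmodule {R V : Type*} [CommRing R] [PartialOrder R] [IsOrderedRing R]
    [AddCommGroup V] [Module R V] (B : LinearMap.BilinForm R V) (W : Submodule R V)
    (hB : ∀ v ∈ W, 0 ≤ B v v) : Submodule R V where
  carrier := {v | v ∈ W ∧ B v v = 0}
  zero_mem' := ⟨zero_mem W, by simp⟩
  smul_mem' c v hv := ⟨W.smul_mem c hv.1, by simp [hv.2]⟩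
  add_mem' {v w} hv hw := by
    have hadd : B (v + w) (v + w) = B v w + B w v := by simp [hv.2, hw.2, add_comm]
    have hsub : B (v - w) (v - w) = -(B v w + B w v) := by
      simp [hv.2, hw.2, sub_eq_add_neg, add_comm]
    refine ⟨add_mem hv.1 hw.1, le_antisymm ?_ (hB _ (add_mem hv.1 hw.1))⟩
    rw [hadd, ← neg_nonneg, ← hsub]
    exact hB _ (sub_mem hv.1 hw.1)

theorem exists_isLieAbelian_le_maximal {R L : Type*} [CommRing R] [LieRing L] [LieAlgebra R L]
    [IsNoetherian R L] (W : Submodule R L) :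
    ∃ 𝔞 : LieSubalgebra R L, IsLieAbelian 𝔞 ∧ 𝔞.toSubmodule ≤ W ∧
      ∀ v ∈ W, (∀ ξ ∈ 𝔞, ⁅v, ξ⁆ = 0) → v ∈ 𝔞 := by
  obtain ⟨𝔞, ⟨hab, h𝔞⟩, hmax⟩ := exists_maximal_of_wellFoundedGT
    (fun 𝔞 : LieSubalgebra R L => IsLieAbelian 𝔞 ∧ 𝔞.toSubmodule ≤ W)
    ⟨⊥, LieSubalgebra.span_empty R L ▸ LieSubalgebra.isLieAbelian_lieSpan_iff.2 (by simp),
      by simp⟩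
  refine ⟨𝔞, hab, h𝔞, fun v hv hcomm => ?_⟩
  have hcomm' : ∀ ξ ∈ insert v (𝔞 : Set L), ∀ η ∈ insert v (𝔞 : Set L), ⁅ξ, η⁆ = 0 := by
    rintro ξ (rfl | hξ) η (rfl | hη)
    · exact lie_self _
    · exact hcomm η hη
    · rw [← lie_skew, hcomm ξ hξ, neg_zero]
    · exact congrArg Subtype.val (hab.trivial ⟨ξ, hξ⟩ ⟨η, hη⟩)
  have hle : (LieSubalgebra.lieSpan R L (insert v (𝔞 : Set L))).toSubmodule ≤ W := by
    rw [LieSubalgebra.coe_lieSpan_eq_span_of_forall_lie_eq_zero hcomm', Submodule.span_le]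
    exact Set.insert_subset hv h𝔞
  exact hmax ⟨LieSubalgebra.isLieAbelian_lieSpan_iff.2 hcomm', hle⟩
    (fun ξ hξ => LieSubalgebra.subset_lieSpan (Set.mem_insert_of_mem v hξ))
    (LieSubalgebra.subset_lieSpan (Set.mem_insert v _))

end Algebra

section IntegralCurves

variable {E H N E' H' N' : Type*} [NormedAddCommGroup E] [NormedSpace ℝ E] [TopologicalSpace H]
  {I : ModelWithCorners ℝ E H} [TopologicalSpace N] [ChartedSpace H N]
  [NormedAddCommGroup E'] [NormedSpace ℝ E'] [TopologicalSpace H']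
  {I' : ModelWithCorners ℝ E' H'} [TopologicalSpace N'] [ChartedSpace H' N']
  {V : (p : N) → TangentSpace I p} {V' : (p : N') → TangentSpace I' p} {f : N → N'} {γ : ℝ → N}

theorem isMIntegralCurveOn_comp_of_mfderiv_eq {s : Set ℝ} (hγ : IsMIntegralCurveOn γ V s)
    (hf : MDifferentiable I I' f) (hV : ∀ p, mfderiv I I' f p (V p) = V' (f p)) :
    IsMIntegralCurveOn (f ∘ γ) V' s := by
  intro t ht
  refine ((hf (γ t)).hasMFDerivAt.comp_hasMFDerivWithinAt t (hγ t ht)).congr_mfderiv ?_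
  ext
  exact (map_smul _ _ _).trans (congrArg _ (hV (γ t)))

theorem isMIntegralCurve_comp_of_mfderiv_eq (hγ : IsMIntegralCurve γ V)
    (hf : MDifferentiable I I' f) (hV : ∀ p, mfderiv I I' f p (V p) = V' (f p)) :
    IsMIntegralCurve (f ∘ γ) V' :=
  (isMIntegralCurve_iff_isMIntegralCurveOn).2
    (isMIntegralCurveOn_comp_of_mfderiv_eq (hγ.isMIntegralCurveOn Set.univ) hf hV)

end IntegralCurves

section Exponential

variable {n : ℕ} {G : Type*} [TopologicalSpace G] [ChartedSpace (EuclideanSpace ℝ (Fin n)) G]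
  [Group G]

theorem mulInvariantVectorField_one (v : GroupLieAlgebra (𝓡 n) G) :
    mulInvariantVectorField v (1 : G) = v := by
  have left_one : ((1 : G) * ·) = id := funext one_mul
  rw [mulInvariantVectorField, left_one, mfderiv_id]
  rfl

variable [LieGroup (𝓡 n) ∞ G]

theorem mdifferentiable_conj (a : G) :
    MDifferentiable (𝓡 n) (𝓡 n) (MulAut.conj a).toMonoidHom :=
  mdifferentiable_mul_right.comp mdifferentiable_mul_left

theorem contMDiff_one_mulInvariantVectorField (v : GroupLieAlgebra (𝓡 n) G) :
    ContMDiff (𝓡 n) (𝓡 n).tangent 1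
      (fun g : G => (⟨g, mulInvariantVectorField v g⟩ : TangentBundle (𝓡 n) G)) :=
  (contMDiff_mulInvariantVectorField v).of_le (le_minSmoothness.trans' (by norm_num))

theorem mfderiv_monoidHom_mulInvariantVectorField {f : G →* G}
    (hf : MDifferentiable (𝓡 n) (𝓡 n) f) (v : GroupLieAlgebra (𝓡 n) G) (g : G) :
    mfderiv (𝓡 n) (𝓡 n) f g (mulInvariantVectorField v g) =
      mulInvariantVectorField (lieDifferential n f v) (f g) := by
  have intertwine : (f ∘ (g * ·) : G → G) = (f g * ·) ∘ f := funext fun h => map_mul f g h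
  have hleft := mfderiv_comp_apply (1 : G) (f := (g * ·)) (hf _) mdifferentiableAt_mul_left v
  have hright := mfderiv_comp_apply (1 : G) (g := (f g * ·)) mdifferentiableAt_mul_left (hf 1) v
  rw [intertwine, hright, mul_one, map_one] at hleft
  exact hleft.symm

theorem mfderiv_mul_left_mulInvariantVectorField (v : GroupLieAlgebra (𝓡 n) G) (a g : G) :
    mfderiv (𝓡 n) (𝓡 n) (a * ·) g (mulInvariantVectorField v g) =
      mulInvariantVectorField v (a * g) := by
  have hcomp := mfderiv_comp_apply (1 : G) (g := (a * ·)) (f := (g * ·))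
    mdifferentiableAt_mul_left mdifferentiableAt_mul_left v
  rw [show (a * ·) ∘ (g * ·) = (a * g * ·) from funext fun h => (mul_assoc a g h).symm,
    mul_one] at hcomp
  exact hcomp.symm

variable [T2Space G]

theorem exists_isMIntegralCurve_mulInvariantVectorField (v : GroupLieAlgebra (𝓡 n) G) :
    ∃ γ : ℝ → G, γ 0 = 1 ∧ IsMIntegralCurve (I := 𝓡 n) γ (mulInvariantVectorField v) := by
  obtain ⟨γ, h0, hγ⟩ := exists_isMIntegralCurveAt_of_contMDiffAt_boundaryless (I := 𝓡 n) 0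
    (contMDiff_one_mulInvariantVectorField v (1 : G))
  obtain ⟨ε, hε, hγ⟩ := isMIntegralCurveAt_iff'.1 hγ
  rw [Real.ball_eq_Ioo, zero_sub, zero_add] at hγ
  -- Left translates of `γ` are integral curves on the same interval, which gives completeness.
  exact exists_isMIntegralCurve_of_isMIntegralCurveOn (contMDiff_one_mulInvariantVectorField v) hε
    (fun g => ⟨(g * ·) ∘ γ, by simp [h0], isMIntegralCurveOn_comp_of_mfderiv_eq hγ
      mdifferentiable_mul_left (mfderiv_mul_left_mulInvariantVectorField v g)⟩) 1

theorem eq_of_isMIntegralCurve_mulInvariantVectorField {γ γ' : ℝ → G}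
    {v : GroupLieAlgebra (𝓡 n) G}
    (hγ : IsMIntegralCurve (I := 𝓡 n) γ (mulInvariantVectorField v))
    (hγ' : IsMIntegralCurve (I := 𝓡 n) γ' (mulInvariantVectorField v)) (h : γ 0 = γ' 0) :
    γ = γ' :=
  isMIntegralCurve_Ioo_eq_of_contMDiff_boundaryless
    (contMDiff_one_mulInvariantVectorField v) hγ hγ' h

theorem lieExp_smul_eq_of_isMIntegralCurve {γ : ℝ → G} {v : GroupLieAlgebra (𝓡 n) G}
    (h0 : γ 0 = 1) (hγ : IsMIntegralCurve (I := 𝓡 n) γ (mulInvariantVectorField v)) (t : ℝ) :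
    lieExp (t • v) = γ t := by
  have hscaled : IsMIntegralCurve (I := 𝓡 n) (γ ∘ (· * t)) (mulInvariantVectorField (t • v)) := by
    rw [mulInvariantVectorField_smul]
    exact hγ.comp_mul t
  have hex : ∃ γ : ℝ → G, γ 0 = 1 ∧
      IsMIntegralCurve (I := 𝓡 n) γ (mulInvariantVectorField (t • v)) :=
    ⟨_, by simp [h0], hscaled⟩
  rw [lieExp, dif_pos hex, eq_of_isMIntegralCurve_mulInvariantVectorField hex.choose_spec.2
    hscaled (by simp [h0, hex.choose_spec.1]), Function.comp_apply, one_mul]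

theorem isMIntegralCurve_lieExp (v : GroupLieAlgebra (𝓡 n) G) :
    IsMIntegralCurve (I := 𝓡 n) (fun t : ℝ => (lieExp (t • v) : G))
      (mulInvariantVectorField v) := by
  obtain ⟨γ, h0, hγ⟩ := exists_isMIntegralCurve_mulInvariantVectorField (G := G) v
  rwa [funext (lieExp_smul_eq_of_isMIntegralCurve h0 hγ)]

theorem isMIntegralCurve_mul_lieExp (g : G) (v : GroupLieAlgebra (𝓡 n) G) :
    IsMIntegralCurve (I := 𝓡 n) (fun t : ℝ => g * lieExp (t • v)) (mulInvariantVectorField v) :=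
  isMIntegralCurve_comp_of_mfderiv_eq (isMIntegralCurve_lieExp v) mdifferentiable_mul_left
    (mfderiv_mul_left_mulInvariantVectorField v g)

theorem lieExp_zero : (lieExp (0 : GroupLieAlgebra (𝓡 n) G) : G) = 1 := by
  obtain ⟨γ, h0, hγ⟩ :=
    exists_isMIntegralCurve_mulInvariantVectorField (0 : GroupLieAlgebra (𝓡 n) G)
  rw [← zero_smul ℝ (0 : GroupLieAlgebra (𝓡 n) G), lieExp_smul_eq_of_isMIntegralCurve h0 hγ, h0]

theorem map_lieExp_smul {f : G →* G} (hf : MDifferentiable (𝓡 n) (𝓡 n) f)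
    (v : GroupLieAlgebra (𝓡 n) G) (t : ℝ) :
    f (lieExp (t • v)) = lieExp (t • lieDifferential n f v) :=
  (lieExp_smul_eq_of_isMIntegralCurve (by simp [lieExp_zero])
    (isMIntegralCurve_comp_of_mfderiv_eq (isMIntegralCurve_lieExp v) hf
      (mfderiv_monoidHom_mulInvariantVectorField hf v)) t).symm

theorem lieExp_add_smul (v : GroupLieAlgebra (𝓡 n) G) (s t : ℝ) :
    (lieExp ((s + t) • v) : G) = lieExp (s • v) * lieExp (t • v) := by
  have hcurves := eq_of_isMIntegralCurve_mulInvariantVectorField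
    ((isMIntegralCurve_lieExp v).comp_add s) (isMIntegralCurve_mul_lieExp (lieExp (s • v)) v)
    (by simp [lieExp_zero])
  simpa [add_comm] using congrFun hcurves t

theorem lieExp_neg_smul (v : GroupLieAlgebra (𝓡 n) G) (t : ℝ) :
    (lieExp ((-t) • v) : G) = (lieExp (t • v))⁻¹ := by
  rw [eq_inv_iff_mul_eq_one, ← lieExp_add_smul, neg_add_cancel, zero_smul, lieExp_zero]

end Exponential

section Differential

theorem isInvertible_mfderiv_of_involutive {E H N : Type*} [NormedAddCommGroup E]
    [NormedSpace ℝ E] [TopologicalSpace H] {I : ModelWithCorners ℝ E H} [TopologicalSpace N]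
    [ChartedSpace H N] {f : N → N} (hf : MDifferentiable I I f) (hinv : Function.Involutive f)
    (p : N) : (mfderiv I I f p).IsInvertible := by
  have hcomp (q : N) : (mfderiv I I f (f q)).comp (mfderiv I I f q) = .id ℝ _ := by
    rw [← mfderiv_comp q (hf (f q)) (hf q), hinv.comp_self, mfderiv_id]
  have hcomp' := hcomp (f p)
  rw [hinv p] at hcomp'
  exact .of_inverse hcomp' (hcomp p)

variable {n : ℕ} {G : Type*} [TopologicalSpace G] [ChartedSpace (EuclideanSpace ℝ (Fin n)) G]
  [Group G] {f : G →* G}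

theorem involutive_lieDifferential (hf : MDifferentiable (𝓡 n) (𝓡 n) f)
    (hinv : Function.Involutive f) : Function.Involutive (lieDifferential n f) := by
  intro ξ
  have hcomp := mfderiv_comp_apply (1 : G) (hf (f 1)) (hf 1) ξ
  rw [hinv.comp_self, mfderiv_id, map_one] at hcomp
  exact hcomp.symm

variable [LieGroup (𝓡 n) ∞ G]

theorem mpullback_mulInvariantVectorField_lieDifferential (hf : MDifferentiable (𝓡 n) (𝓡 n) f)
    (hf' : ∀ g, (mfderiv (𝓡 n) (𝓡 n) f g).IsInvertible) (v : GroupLieAlgebra (𝓡 n) G) :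
    VectorField.mpullback (𝓡 n) (𝓡 n) f (mulInvariantVectorField (lieDifferential n f v)) =
      mulInvariantVectorField v := by
  ext1 g
  rw [VectorField.mpullback_apply, ← mfderiv_monoidHom_mulInvariantVectorField hf,
    (hf' g).inverse_apply_self]

theorem lieDifferential_lie (hf : ContMDiff (𝓡 n) (𝓡 n) 2 f)
    (hf' : ∀ g, (mfderiv (𝓡 n) (𝓡 n) f g).IsInvertible) (v w : GroupLieAlgebra (𝓡 n) G) :
    lieDifferential n f ⁅v, w⁆ = ⁅lieDifferential n f v, lieDifferential n f w⁆ := by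
  have hd : MDifferentiable (𝓡 n) (𝓡 n) f := hf.mdifferentiable two_ne_zero
  have hpull := VectorField.mpullback_mlieBracket (x₀ := (1 : G))
    (mdifferentiableAt_mulInvariantVectorField (lieDifferential n f v))
    (mdifferentiableAt_mulInvariantVectorField (lieDifferential n f w)) (hf 1)
    minSmoothness_of_isRCLikeNormedField.le
  rw [mpullback_mulInvariantVectorField_lieDifferential hd hf',
    mpullback_mulInvariantVectorField_lieDifferential hd hf', VectorField.mpullback_apply,
    (hf' 1).inverse_apply_eq, map_one] at hpull
  exact hpull.symm

variable (n) in
/-- The differential of a smooth automorphism as a Lie algebra homomorphism. -/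
noncomputable def lieDifferentialHom (f : G →* G) (hf : ContMDiff (𝓡 n) (𝓡 n) 2 f)
    (hf' : ∀ g, (mfderiv (𝓡 n) (𝓡 n) f g).IsInvertible) :
    GroupLieAlgebra (𝓡 n) G →ₗ⁅ℝ⁆ GroupLieAlgebra (𝓡 n) G :=
  { lieDifferential n f with map_lie' := fun {v w} => lieDifferential_lie hf hf' v w }

end Differential

section InvariantDerivatives

variable {n : ℕ} {G : Type*} [TopologicalSpace G] [ChartedSpace (EuclideanSpace ℝ (Fin n)) G]
  [Group G] {φ : G → ℝ}

/-- The derivative of a function on `G` along the left-invariant vector field of `w`. -/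
noncomputable def invariantDeriv (φ : G → ℝ) (w : GroupLieAlgebra (𝓡 n) G) (g : G) : ℝ :=
  mfderiv (𝓡 n) 𝓘(ℝ, ℝ) φ g (mulInvariantVectorField w g)

theorem invariantDeriv_add (φ : G → ℝ) (v w : GroupLieAlgebra (𝓡 n) G) :
    invariantDeriv φ (v + w) = invariantDeriv φ v + invariantDeriv φ w := by
  ext g
  rw [invariantDeriv, mulInvariantVectorField_add]
  exact map_add _ _ _

theorem invariantDeriv_smul (φ : G → ℝ) (c : ℝ) (v : GroupLieAlgebra (𝓡 n) G) :
    invariantDeriv φ (c • v) = c • invariantDeriv φ v := by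
  ext g
  rw [invariantDeriv, mulInvariantVectorField_smul]
  exact map_smul (mfderiv (𝓡 n) 𝓘(ℝ, ℝ) φ g) c (mulInvariantVectorField v g)

theorem invariantDeriv_one (φ : G → ℝ) (v : GroupLieAlgebra (𝓡 n) G) :
    invariantDeriv φ v 1 = mfderiv (𝓡 n) 𝓘(ℝ, ℝ) φ 1 v := by
  rw [invariantDeriv, mulInvariantVectorField_one]

variable [LieGroup (𝓡 n) ∞ G]

theorem mdifferentiable_invariantDeriv (hφ : ContMDiff (𝓡 n) 𝓘(ℝ, ℝ) 2 φ)
    (w : GroupLieAlgebra (𝓡 n) G) : MDifferentiable (𝓡 n) 𝓘(ℝ, ℝ) (invariantDeriv φ w) :=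
  ((contMDiff_snd_tangentBundle_modelSpace ℝ 𝓘(ℝ, ℝ)).comp
    ((hφ.contMDiff_tangentMap (m := 1) (by norm_num)).comp
      (contMDiff_one_mulInvariantVectorField w))).mdifferentiable one_ne_zero

/-- The second derivative `(v, w) ↦ (v (w φ)) 1` along left-invariant fields. It need not be
symmetric, unless `1` is a critical point of `φ`. -/
noncomputable def invariantHessian (hφ : ContMDiff (𝓡 n) 𝓘(ℝ, ℝ) 2 φ) :
    LinearMap.BilinForm ℝ (GroupLieAlgebra (𝓡 n) G) :=
  LinearMap.mk₂ ℝ (fun v w => invariantDeriv (invariantDeriv φ w) v 1)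
    (fun v v' w => by rw [invariantDeriv_add]; rfl)
    (fun c v w => by rw [invariantDeriv_smul]; rfl)
    (fun v w w' => by
      simp only [invariantDeriv_add φ w, invariantDeriv_one]
      rw [mfderiv_add (mdifferentiable_invariantDeriv hφ w 1)
          (mdifferentiable_invariantDeriv hφ w' 1)]
      rfl)
    (fun c v w => by
      rw [invariantDeriv_smul, invariantDeriv_one, invariantDeriv_one,
        const_smul_mfderiv (mdifferentiable_invariantDeriv hφ w 1)]
      rfl)

variable [T2Space G]

theorem hasDerivAt_comp_mul_lieExp (hφ : MDifferentiable (𝓡 n) 𝓘(ℝ, ℝ) φ) (g : G)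
    (v : GroupLieAlgebra (𝓡 n) G) (t : ℝ) :
    HasDerivAt (fun s : ℝ => φ (g * lieExp (s • v)))
      (invariantDeriv φ v (g * lieExp (t • v))) t := by
  refine (((hφ _).hasMFDerivAt.comp t (isMIntegralCurve_mul_lieExp g v t)).congr_mfderiv
    (f₁' := .toSpanSingleton ℝ (invariantDeriv φ v _)) ?_).hasFDerivAt
  ext
  exact map_smul (mfderiv (𝓡 n) 𝓘(ℝ, ℝ) φ (g * lieExp (t • v))) (1 : ℝ)
    (mulInvariantVectorField v (g * lieExp (t • v)))

theorem hasDerivAt_comp_mul_lieExp_zero (hφ : MDifferentiable (𝓡 n) 𝓘(ℝ, ℝ) φ) (g : G)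
    (v : GroupLieAlgebra (𝓡 n) G) :
    HasDerivAt (fun s : ℝ => φ (g * lieExp (s • v))) (invariantDeriv φ v g) 0 := by
  simpa [lieExp_zero] using hasDerivAt_comp_mul_lieExp hφ g v 0

theorem deriv_comp_lieExp (hφ : MDifferentiable (𝓡 n) 𝓘(ℝ, ℝ) φ)
    (v : GroupLieAlgebra (𝓡 n) G) :
    deriv (fun s : ℝ => φ (lieExp (s • v))) = fun t => invariantDeriv φ v (lieExp (t • v)) := by
  ext t
  simpa using (hasDerivAt_comp_mul_lieExp hφ 1 v t).deriv

theorem invariantHessian_apply (hφ : ContMDiff (𝓡 n) 𝓘(ℝ, ℝ) 2 φ)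
    (v w : GroupLieAlgebra (𝓡 n) G) :
    invariantHessian hφ v w = deriv (fun t : ℝ => invariantDeriv φ w (lieExp (t • v))) 0 := by
  simp only [deriv_comp_lieExp (mdifferentiable_invariantDeriv hφ w), zero_smul, lieExp_zero]
  rfl

theorem iteratedDeriv_two_comp_lieExp (hφ : ContMDiff (𝓡 n) 𝓘(ℝ, ℝ) 2 φ)
    (v : GroupLieAlgebra (𝓡 n) G) :
    iteratedDeriv 2 (fun t : ℝ => φ (lieExp (t • v))) 0 = invariantHessian hφ v v := by
  rw [iteratedDeriv_succ, iteratedDeriv_one,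
    deriv_comp_lieExp (hφ.mdifferentiable two_ne_zero), invariantHessian_apply]

theorem invariantDeriv_eq_zero_of_mul_lieExp (hφ : MDifferentiable (𝓡 n) 𝓘(ℝ, ℝ) φ) {g : G}
    {w : GroupLieAlgebra (𝓡 n) G} (hw : ∀ t : ℝ, φ (g * lieExp (t • w)) = φ g) :
    invariantDeriv φ w g = 0 := by
  have hderiv := hasDerivAt_comp_mul_lieExp_zero hφ g w
  simp only [hw] at hderiv
  exact hderiv.unique (hasDerivAt_const _ _)

theorem invariantDeriv_eq_of_mul_lieExp (hφ : MDifferentiable (𝓡 n) 𝓘(ℝ, ℝ) φ) {g g' : G}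
    {w w' : GroupLieAlgebra (𝓡 n) G} {c : ℝ}
    (hww' : ∀ t : ℝ, φ (g * lieExp (t • w)) = c + φ (g' * lieExp (t • w'))) :
    invariantDeriv φ w g = invariantDeriv φ w' g' := by
  have hderiv := hasDerivAt_comp_mul_lieExp_zero hφ g w
  simp only [hww'] at hderiv
  exact hderiv.unique ((hasDerivAt_comp_mul_lieExp_zero hφ g' w').const_add c)

theorem invariantHessian_left_eq_zero (hφ : ContMDiff (𝓡 n) 𝓘(ℝ, ℝ) 2 φ)
    {ξ w : GroupLieAlgebra (𝓡 n) G} (hw : ∀ t : ℝ, invariantDeriv φ w (lieExp (t • ξ)) = 0) :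
    invariantHessian hφ ξ w = 0 := by
  rw [invariantHessian_apply]
  simp only [hw, deriv_const]

theorem invariantHessian_eq_zero_of_lieExp_mul (hφ : ContMDiff (𝓡 n) 𝓘(ℝ, ℝ) 2 φ)
    (hcrit : ∀ w : GroupLieAlgebra (𝓡 n) G, invariantDeriv φ w 1 = 0)
    {ξ : GroupLieAlgebra (𝓡 n) G}
    (hξ : ∀ (t : ℝ) (h : G), φ (lieExp (t • ξ) * h) = φ (lieExp (t • ξ)) + φ h)
    (w : GroupLieAlgebra (𝓡 n) G) : invariantHessian hφ ξ w = 0 := by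
  refine invariantHessian_left_eq_zero hφ fun t => ?_
  rw [← hcrit w]
  exact invariantDeriv_eq_of_mul_lieExp (hφ.mdifferentiable two_ne_zero)
    fun s => by rw [hξ, one_mul]

theorem invariantHessian_right_eq_zero_of_mul_lieExp (hφ : ContMDiff (𝓡 n) 𝓘(ℝ, ℝ) 2 φ)
    {a : GroupLieAlgebra (𝓡 n) G} (ha : ∀ (g : G) (t : ℝ), φ (g * lieExp (t • a)) = φ g)
    (v : GroupLieAlgebra (𝓡 n) G) : invariantHessian hφ v a = 0 :=
  invariantHessian_left_eq_zero hφ fun _ =>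
    invariantDeriv_eq_zero_of_mul_lieExp (hφ.mdifferentiable two_ne_zero) (ha _)

theorem invariantHessian_left_eq_zero_of_mul_lieExp (hφ : ContMDiff (𝓡 n) 𝓘(ℝ, ℝ) 2 φ)
    (hcrit : ∀ w : GroupLieAlgebra (𝓡 n) G, invariantDeriv φ w 1 = 0)
    {a : GroupLieAlgebra (𝓡 n) G} (ha : ∀ (g : G) (t : ℝ), φ (g * lieExp (t • a)) = φ g)
    (w : GroupLieAlgebra (𝓡 n) G) : invariantHessian hφ a w = 0 := by
  refine invariantHessian_left_eq_zero hφ fun t => ?_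
  -- Right invariance under `k = exp (t a)` gives `φ (k exp (s w)) = φ (exp (s Ad(k) w))`.
  have hconj (s : ℝ) : φ (lieExp (t • a) * lieExp (s • w)) =
      0 + φ (1 * lieExp (s • lieAd n (lieExp (t • a)) w)) := by
    rw [zero_add, one_mul, lieAd, ← map_lieExp_smul (mdifferentiable_conj _),
      MulEquiv.toMonoidHom_eq_coe, MonoidHom.coe_coe, MulAut.conj_apply, ← lieExp_neg_smul, ha]
  rw [invariantDeriv_eq_of_mul_lieExp (hφ.mdifferentiable two_ne_zero) hconj, hcrit]

theorem invariantHessian_eq_zero_of_add (hφ : ContMDiff (𝓡 n) 𝓘(ℝ, ℝ) 2 φ)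
    (hcrit : ∀ w : GroupLieAlgebra (𝓡 n) G, invariantDeriv φ w 1 = 0)
    {a b : GroupLieAlgebra (𝓡 n) G} (ha : ∀ (g : G) (t : ℝ), φ (g * lieExp (t • a)) = φ g)
    (hab : ∀ (t : ℝ) (h : G), φ (lieExp (t • (a + b)) * h) = φ (lieExp (t • (a + b))) + φ h) :
    invariantHessian hφ b b = 0 := by
  have hsum := invariantHessian_eq_zero_of_lieExp_mul hφ hcrit hab (a + b)
  rwa [map_add, invariantHessian_right_eq_zero_of_mul_lieExp hφ ha, zero_add, map_add,
    LinearMap.add_apply, invariantHessian_left_eq_zero_of_mul_lieExp hφ hcrit ha,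
    zero_add] at hsum

end InvariantDerivatives

section DerivedSubalgebra

variable {n : ℕ} {G : Type*} [TopologicalSpace G] [ChartedSpace (EuclideanSpace ℝ (Fin n)) G]
  [Group G] [LieGroup (𝓡 n) ∞ G] {𝔥 𝔞 : LieSubalgebra ℝ (GroupLieAlgebra (𝓡 n) G)}

theorem lie_mem_derivedSubalgebra {v w : GroupLieAlgebra (𝓡 n) G} (hv : v ∈ 𝔥) (hw : w ∈ 𝔥) :
    ⁅v, w⁆ ∈ derivedSubalgebra n 𝔥 :=
  ⟨⁅(⟨v, hv⟩ : 𝔥), ⟨w, hw⟩⁆,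
    LieSubmodule.lie_mem_lie (LieSubmodule.mem_top _) (LieSubmodule.mem_top _), rfl⟩

theorem derivedSubalgebra_toSubmodule_le {W : Submodule ℝ (GroupLieAlgebra (𝓡 n) G)}
    (hW : ∀ v ∈ 𝔥, ∀ w ∈ 𝔥, ⁅v, w⁆ ∈ W) : (derivedSubalgebra n 𝔥).toSubmodule ≤ W := by
  rintro _ ⟨η, hη, rfl⟩
  have hle : (LieAlgebra.derivedSeries ℝ 𝔥 1).toLieSubalgebra.toSubmodule ≤
      W.comap 𝔥.toSubmodule.subtype := by
    rw [LieAlgebra.coe_derivedSeries_one_eq, Submodule.span_le]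
    rintro _ ⟨v, w, rfl⟩
    exact hW v v.2 w w.2
  exact hle hη

theorem derivedSubalgebra_le : derivedSubalgebra n 𝔥 ≤ 𝔥 :=
  derivedSubalgebra_toSubmodule_le (W := 𝔥.toSubmodule) fun _ hv _ hw => 𝔥.lie_mem hv hw

theorem derivedSubalgebra_toSubmodule_le_derivedSeries :
    (derivedSubalgebra n 𝔥).toSubmodule ≤
      (LieAlgebra.derivedSeries ℝ (GroupLieAlgebra (𝓡 n) G) 1).toSubmodule :=
  derivedSubalgebra_toSubmodule_le fun v _ w _ =>
    LieSubmodule.lie_mem_lie (LieSubmodule.mem_top v) (LieSubmodule.mem_top w)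

theorem map_mem_derivedSubalgebra
    {σ : GroupLieAlgebra (𝓡 n) G →ₗ⁅ℝ⁆ GroupLieAlgebra (𝓡 n) G} (hσ : ∀ v ∈ 𝔥, σ v ∈ 𝔥)
    {η : GroupLieAlgebra (𝓡 n) G} (hη : η ∈ derivedSubalgebra n 𝔥) :
    σ η ∈ derivedSubalgebra n 𝔥 := by
  have hle : (derivedSubalgebra n 𝔥).toSubmodule ≤
      (derivedSubalgebra n 𝔥).toSubmodule.comap (σ : _ →ₗ[ℝ] _) :=
    derivedSubalgebra_toSubmodule_le fun v hv w hw => by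
      rw [Submodule.mem_comap, LieHom.coe_toLinearMap, LieHom.map_lie]
      exact lie_mem_derivedSubalgebra (hσ v hv) (hσ w hw)
  exact hle hη

theorem map_mem_algebraCentralizer
    {σ : GroupLieAlgebra (𝓡 n) G →ₗ⁅ℝ⁆ GroupLieAlgebra (𝓡 n) G} (hσ : 𝔞 ≤ 𝔞.map σ)
    {η : GroupLieAlgebra (𝓡 n) G} (hη : η ∈ algebraCentralizer n 𝔞) :
    σ η ∈ algebraCentralizer n 𝔞 := by
  intro ξ hξ
  obtain ⟨ζ, hζ, rfl⟩ := hσ hξ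
  exact (σ.map_lie η ζ).symm.trans ((congrArg σ (hη ζ hζ)).trans (map_zero σ))

theorem killingForm_eq_zero_of_mem_derivedSubalgebra_algebraCentralizer
    {ζ η : GroupLieAlgebra (𝓡 n) G} (hζ : ζ ∈ 𝔞)
    (hη : η ∈ derivedSubalgebra n (algebraCentralizer n 𝔞)) :
    killingForm ℝ (GroupLieAlgebra (𝓡 n) G) ζ η = 0 := by
  have hle : (derivedSubalgebra n (algebraCentralizer n 𝔞)).toSubmodule ≤
      LinearMap.ker (killingForm ℝ (GroupLieAlgebra (𝓡 n) G) ζ) :=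
    derivedSubalgebra_toSubmodule_le fun v hv w _ => by
      rw [LinearMap.mem_ker, killingForm, ← LieModule.traceForm_apply_lie_apply, ← lie_skew,
        hv ζ hζ, neg_zero, map_zero, LinearMap.zero_apply]
  exact hle hη

end DerivedSubalgebra

section KempfNess

variable {n : ℕ} {G : Type*} [TopologicalSpace G] [ChartedSpace (EuclideanSpace ℝ (Fin n)) G]
  [Group G] {M : Type*} {θ : G ≃* G} {Ψ : M → G → ℝ} {y : M}

/-- The function `g ↦ Ψ(y, g⁻¹)` attached to a Kempf–Ness function. The inversion turns left
`K`-invariance into right `K`-invariance, which left-invariant vector fields can see. -/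
def kempfNessPotential (Ψ : M → G → ℝ) (y : M) (g : G) : ℝ :=
  Ψ y g⁻¹

theorem mem_kPart_iff {ξ : GroupLieAlgebra (𝓡 n) G} :
    ξ ∈ kPart n θ ↔ lieDifferential n θ.toMonoidHom ξ = ξ := by
  rw [kPart, Module.End.mem_eigenspace_iff, one_smul]

theorem mem_pPart_iff {ξ : GroupLieAlgebra (𝓡 n) G} :
    ξ ∈ pPart n θ ↔ lieDifferential n θ.toMonoidHom ξ = -ξ := by
  rw [pPart, Module.End.mem_eigenspace_iff, neg_one_smul]

section OneParameterSubgroup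

variable [LieGroup (𝓡 n) ∞ G] [T2Space G]

theorem lieExp_mem_fixedSubgroup (hθ : MDifferentiable (𝓡 n) (𝓡 n) θ)
    {w : GroupLieAlgebra (𝓡 n) G} (hw : w ∈ kPart n θ) (t : ℝ) :
    lieExp (t • w) ∈ fixedSubgroup θ := by
  have hmap := map_lieExp_smul (f := θ.toMonoidHom) hθ w t
  rwa [mem_kPart_iff.1 hw] at hmap

theorem potential_lieExp (Ψ : M → G → ℝ) (y : M) (v : GroupLieAlgebra (𝓡 n) G) (t : ℝ) :
    kempfNessPotential Ψ y (lieExp (t • v)) = Ψ y (lieExp ((-t) • v)) := by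
  rw [kempfNessPotential, lieExp_neg_smul]

end OneParameterSubgroup

variable [MulAction G M]

theorem IsPolystable.of_gradientMap_eq_zero [LieGroup (𝓡 n) ∞ G]
    (hy : ∀ v ∈ pPart n θ, gradientMap n Ψ y v = 0) (H : Subgroup G)
    (𝔥 : LieSubalgebra ℝ (GroupLieAlgebra (𝓡 n) G)) :
    IsPolystable θ Ψ H 𝔥 y :=
  ⟨1, H.one_mem, fun v _ hv => (one_smul G y).symm ▸ hy v hv⟩

variable [TopologicalSpace M]

theorem IsKempfNess.potential_stabilizer_mul (hΨ : IsKempfNess (n := n) θ Ψ) {g : G}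
    (hg : g ∈ MulAction.stabilizer G y) (h : G) :
    kempfNessPotential Ψ y (g * h) = kempfNessPotential Ψ y g + kempfNessPotential Ψ y h := by
  have hcocycle := hΨ.cocycle y g⁻¹ h⁻¹
  rw [MulAction.mem_stabilizer_iff.1 (inv_mem hg), ← mul_inv_rev] at hcocycle
  exact hcocycle.symm

theorem IsKempfNess.potential_mul_fixedSubgroup (hΨ : IsKempfNess (n := n) θ Ψ) {k : G}
    (hk : k ∈ fixedSubgroup θ) (g : G) :
    kempfNessPotential Ψ y (g * k) = kempfNessPotential Ψ y g := by
  rw [kempfNessPotential, mul_inv_rev, hΨ.left_invariant y _ (inv_mem hk), kempfNessPotential]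

variable [LieGroup (𝓡 n) ∞ G]

theorem IsKempfNess.contMDiff_potential (hΨ : IsKempfNess (n := n) θ Ψ) (y : M) :
    ContMDiff (𝓡 n) 𝓘(ℝ, ℝ) 2 (kempfNessPotential Ψ y) :=
  ((hΨ.smooth y).comp (contMDiff_inv (𝓡 n) ∞)).of_le (WithTop.coe_le_coe.2 le_top)

variable [T2Space G]

theorem IsKempfNess.invariantDeriv_potential_one (hΨ : IsKempfNess (n := n) θ Ψ)
    (v : GroupLieAlgebra (𝓡 n) G) :
    invariantDeriv (kempfNessPotential Ψ y) v 1 = -gradientMap n Ψ y v := by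
  have hderiv := (hasDerivAt_comp_mul_lieExp_zero
    ((hΨ.contMDiff_potential y).mdifferentiable two_ne_zero) 1 v).deriv
  simp only [one_mul, potential_lieExp] at hderiv
  rw [← hderiv, deriv_comp_neg (fun t : ℝ => Ψ y (lieExp (t • v))), neg_zero, gradientMap]

theorem IsKempfNess.iteratedDeriv_two_eq_invariantHessian (hΨ : IsKempfNess (n := n) θ Ψ)
    (v : GroupLieAlgebra (𝓡 n) G) :
    iteratedDeriv 2 (fun t : ℝ => Ψ y (lieExp (t • v))) 0 =
      invariantHessian (hΨ.contMDiff_potential y) v v := by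
  rw [← iteratedDeriv_two_comp_lieExp]
  simp only [potential_lieExp]
  rw [iteratedDeriv_comp_neg 2 (fun t : ℝ => Ψ y (lieExp (t • v))), neg_zero, neg_one_sq, one_smul]

theorem IsKempfNess.invariantDeriv_potential_one_eq_zero (hΨ : IsKempfNess (n := n) θ Ψ)
    (hθ : MDifferentiable (𝓡 n) (𝓡 n) θ) (hinv : Function.Involutive θ)
    (hy : ∀ v ∈ pPart n θ, gradientMap n Ψ y v = 0) (w : GroupLieAlgebra (𝓡 n) G) :
    invariantDeriv (kempfNessPotential Ψ y) w 1 = 0 := by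
  obtain ⟨a, ⟨-, ha⟩, b, ⟨-, hb⟩, rfl⟩ := exists_add_eq_of_involutive
    (involutive_lieDifferential (f := θ.toMonoidHom) hθ hinv) (W := ⊤)
    (fun _ _ => Submodule.mem_top) (Submodule.mem_top (x := w))
  have ha' : invariantDeriv (kempfNessPotential Ψ y) a 1 = 0 :=
    invariantDeriv_eq_zero_of_mul_lieExp ((hΨ.contMDiff_potential y).mdifferentiable two_ne_zero)
      fun t => hΨ.potential_mul_fixedSubgroup (lieExp_mem_fixedSubgroup hθ ha t) 1
  rw [invariantDeriv_add, Pi.add_apply, ha', zero_add, hΨ.invariantDeriv_potential_one, hy b hb,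
    neg_zero]

theorem IsKempfNess.mem_stabilizerAlgebra_iff (hΨ : IsKempfNess (n := n) θ Ψ)
    {v : GroupLieAlgebra (𝓡 n) G} (hv : v ∈ pPart n θ) :
    v ∈ stabilizerAlgebra G y ↔ invariantHessian (hΨ.contMDiff_potential y) v v = 0 := by
  rw [← hΨ.iteratedDeriv_two_eq_invariantHessian]
  exact (hΨ.strict y v hv).symm

/-- The subspace `𝔭 ∩ 𝔤_y`, as the isotropic vectors in `𝔭` of the Hessian of the Kempf–Ness
potential: this is what makes it closed under addition. -/
noncomputable def IsKempfNess.pStabilizer (hΨ : IsKempfNess (n := n) θ Ψ) (y : M) :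
    Submodule ℝ (GroupLieAlgebra (𝓡 n) G) :=
  isotropicSubmodule (invariantHessian (hΨ.contMDiff_potential y)) (pPart n θ) fun v hv =>
    hΨ.iteratedDeriv_two_eq_invariantHessian v ▸ hΨ.convex y v hv 0

theorem IsKempfNess.mem_pStabilizer_iff (hΨ : IsKempfNess (n := n) θ Ψ)
    {v : GroupLieAlgebra (𝓡 n) G} :
    v ∈ hΨ.pStabilizer y ↔ v ∈ pPart n θ ∧ v ∈ stabilizerAlgebra G y :=
  and_congr_right fun hv => (hΨ.mem_stabilizerAlgebra_iff hv).symm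

theorem IsKempfNess.mem_stabilizerAlgebra_of_add_mem (hΨ : IsKempfNess (n := n) θ Ψ)
    (hθ : MDifferentiable (𝓡 n) (𝓡 n) θ) (hinv : Function.Involutive θ)
    (hy : ∀ v ∈ pPart n θ, gradientMap n Ψ y v = 0) {a b : GroupLieAlgebra (𝓡 n) G}
    (ha : a ∈ kPart n θ) (hb : b ∈ pPart n θ) (hab : a + b ∈ stabilizerAlgebra G y) :
    b ∈ stabilizerAlgebra G y :=
  (hΨ.mem_stabilizerAlgebra_iff hb).2 <| invariantHessian_eq_zero_of_add _
    (hΨ.invariantDeriv_potential_one_eq_zero hθ hinv hy)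
    (fun g t => hΨ.potential_mul_fixedSubgroup (lieExp_mem_fixedSubgroup hθ ha t) g)
    (fun t h => hΨ.potential_stabilizer_mul (hab t) h)

theorem IsKempfNess.mem_kPart_of_mem_derivedSubalgebra (hΨ : IsKempfNess (n := n) θ Ψ)
    (hθ : ContMDiff (𝓡 n) (𝓡 n) 2 θ) (hinv : Function.Involutive θ)
    (hB : ∀ v ∈ LieAlgebra.derivedSeries ℝ (GroupLieAlgebra (𝓡 n) G) 1, v ∈ pPart n θ →
      killingForm ℝ (GroupLieAlgebra (𝓡 n) G) v v = 0 → v = 0)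
    (hy : ∀ v ∈ pPart n θ, gradientMap n Ψ y v = 0)
    {𝔞 : LieSubalgebra ℝ (GroupLieAlgebra (𝓡 n) G)} (h𝔞 : 𝔞.toSubmodule ≤ pPart n θ)
    (hmax : ∀ v ∈ hΨ.pStabilizer y, (∀ ξ ∈ 𝔞, ⁅v, ξ⁆ = 0) → v ∈ 𝔞)
    {ξ : GroupLieAlgebra (𝓡 n) G} (hξ : ξ ∈ derivedSubalgebra n (algebraCentralizer n 𝔞))
    (hξy : ξ ∈ stabilizerAlgebra G y) : ξ ∈ kPart n θ := by
  have hd : MDifferentiable (𝓡 n) (𝓡 n) θ := hθ.mdifferentiable two_ne_zero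
  let σ := lieDifferentialHom n θ.toMonoidHom hθ (isInvertible_mfderiv_of_involutive hd hinv)
  have h𝔞σ : 𝔞 ≤ 𝔞.map σ := fun ζ hζ =>
    ⟨-ζ, neg_mem hζ, (map_neg σ ζ).trans (neg_eq_iff_eq_neg.2 (mem_pPart_iff.1 (h𝔞 hζ)))⟩
  obtain ⟨a, ⟨-, ha⟩, b, ⟨hb, hbp⟩, rfl⟩ := exists_add_eq_of_involutive
    (involutive_lieDifferential (f := θ.toMonoidHom) hd hinv)
    (W := (derivedSubalgebra n (algebraCentralizer n 𝔞)).toSubmodule)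
    (fun _ => map_mem_derivedSubalgebra (σ := σ) fun _ => map_mem_algebraCentralizer h𝔞σ) hξ
  have hby : b ∈ stabilizerAlgebra G y :=
    hΨ.mem_stabilizerAlgebra_of_add_mem hd hinv hy ha hbp hξy
  have hb𝔞 : b ∈ 𝔞 := hmax b (hΨ.mem_pStabilizer_iff.2 ⟨hbp, hby⟩) (derivedSubalgebra_le hb)
  have hb0 : b = 0 := hB b (derivedSubalgebra_toSubmodule_le_derivedSeries hb) hbp
    (killingForm_eq_zero_of_mem_derivedSubalgebra_algebraCentralizer hb𝔞 hb)
  rwa [hb0, add_zero]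

end KempfNess

theorem IsCartanInvolution.eq_zero_of_killingForm_self_eq_zero {n : ℕ} {G : Type*}
    [TopologicalSpace G] [ChartedSpace (EuclideanSpace ℝ (Fin n)) G] [Group G]
    [LieGroup (𝓡 n) ∞ G] {θ : G ≃* G} (hθ : IsCartanInvolution n θ)
    (v : GroupLieAlgebra (𝓡 n) G)
    (hv : v ∈ LieAlgebra.derivedSeries ℝ (GroupLieAlgebra (𝓡 n) G) 1) (hvp : v ∈ pPart n θ)
    (hvv : killingForm ℝ (GroupLieAlgebra (𝓡 n) G) v v = 0) : v = 0 := by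
  by_contra hv0
  have hneg := hθ.killing_neg v hv hv0
  rw [mem_pPart_iff.1 hvp, map_neg, hvv, neg_zero] at hneg
  exact lt_irrefl 0 hneg

theorem mainTheorem12_general {n : ℕ} {G : Type*} [TopologicalSpace G] [T2Space G]
    [ChartedSpace (EuclideanSpace ℝ (Fin n)) G] [Group G] [LieGroup (𝓡 n) ∞ G]
    (θ : G ≃* G) (hθ : ContMDiff (𝓡 n) (𝓡 n) 2 θ) (hinv : ∀ g, θ (θ g) = g)
    (hB : ∀ v ∈ LieAlgebra.derivedSeries ℝ (GroupLieAlgebra (𝓡 n) G) 1, v ∈ pPart n θ →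
      killingForm ℝ (GroupLieAlgebra (𝓡 n) G) v v = 0 → v = 0)
    {M : Type*} [TopologicalSpace M] [MulAction G M]
    (Ψ : M → G → ℝ) (hΨ : IsKempfNess (n := n) θ Ψ)
    (x : M) (hx : IsPolystable (n := n) θ Ψ ⊤ ⊤ x) :
    ∃ (g : G) (𝔞 : LieSubalgebra ℝ (GroupLieAlgebra (𝓡 n) G)),
      IsLieAbelian 𝔞 ∧
      (∀ ξ ∈ 𝔞, ξ ∈ pPart n θ) ∧
      (∀ ξ ∈ 𝔞, ξ ∈ stabilizerAlgebra G (g • x)) ∧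
      IsPolystable θ Ψ (groupCentralizer n 𝔞) (algebraCentralizer n 𝔞) (g • x) ∧
      IsStable θ Ψ (analyticSubgroup n (derivedSubalgebra n (algebraCentralizer n 𝔞)))
        (derivedSubalgebra n (algebraCentralizer n 𝔞)) (g • x) := by
  obtain ⟨g, -, hg⟩ := hx
  have hy : ∀ v ∈ pPart n θ, gradientMap n Ψ (g • x) v = 0 := fun v => hg v trivial
  have : FiniteDimensional ℝ (GroupLieAlgebra (𝓡 n) G) :=
    inferInstanceAs (FiniteDimensional ℝ (EuclideanSpace ℝ (Fin n)))
  obtain ⟨𝔞, hab, h𝔞, hmax⟩ := exists_isLieAbelian_le_maximal (hΨ.pStabilizer (g • x))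
  have hp : ∀ ξ ∈ 𝔞, ξ ∈ pPart n θ := fun ξ hξ => (hΨ.mem_pStabilizer_iff.1 (h𝔞 hξ)).1
  have hstab : ∀ ξ ∈ 𝔞, ξ ∈ stabilizerAlgebra G (g • x) :=
    fun ξ hξ => (hΨ.mem_pStabilizer_iff.1 (h𝔞 hξ)).2
  refine ⟨g, 𝔞, hab, hp, hstab, .of_gradientMap_eq_zero hy _ _, .of_gradientMap_eq_zero hy _ _,
    1, one_mem _, fun ξ hξ hξx => ?_⟩
  rw [lieAd_one]
  exact ⟨hξ, hΨ.mem_kPart_of_mem_derivedSubalgebra hθ hinv hB hy hp hmax hξ hξx⟩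

theorem mainTheorem12 {n : ℕ} {G : Type*} [TopologicalSpace G] [T2Space G]
    [ChartedSpace (EuclideanSpace ℝ (Fin n)) G] [Group G] [LieGroup (𝓡 n) ∞ G]
    (hG : IsRealReductive n G) (θ : G ≃* G) (hθ : IsCartanInvolution n θ)
    {M : Type*} [TopologicalSpace M] [T2Space M] [MulAction G M] [ContinuousSMul G M]
    (Ψ : M → G → ℝ) (hΨ : IsKempfNess (n := n) θ Ψ)
    (x : M) (hx : IsPolystable (n := n) θ Ψ ⊤ ⊤ x) :
    ∃ (g : G) (𝔞 : LieSubalgebra ℝ (GroupLieAlgebra (𝓡 n) G)),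
      IsLieAbelian 𝔞 ∧
      (∀ ξ ∈ 𝔞, ξ ∈ pPart n θ) ∧
      (∀ ξ ∈ 𝔞, ξ ∈ stabilizerAlgebra G (g • x)) ∧
      IsPolystable θ Ψ (groupCentralizer n 𝔞) (algebraCentralizer n 𝔞) (g • x) ∧
      IsStable θ Ψ (analyticSubgroup n (derivedSubalgebra n (algebraCentralizer n 𝔞)))
        (derivedSubalgebra n (algebraCentralizer n 𝔞)) (g • x) :=
  mainTheorem12_general θ (hθ.smooth.of_le (WithTop.coe_le_coe.2 le_top)) hθ.involutive
    hθ.eq_zero_of_killingForm_self_eq_zero Ψ hΨ x hx
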